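/- Let $G$ be a finite simple connected graph with at least two vertices, let $\lambda_2(G)$ be the second largest eigenvalue (counted with multiplicity) of its adjacency matrix, and let $m_{\lambda_2(G)}$ be the multiplicity of this eigenvalue. For positive integers $n$ let $T(n,n,n)$ be the graph consisting of three paths with $n$ edges each that share exactly their initial vertex, and let $\lambda_1(T(n,n,n))$ be its largest adjacency eigenvalue. Let $\Delta$ and $\lambda$ be real numbers such that the maximum degree of $G$ is at most $\Delta$ and $\lambda_2(G)\le\lambda<3/\sqrt2$. Then there is a least positive integer $n_\lambda$ with $\lambda_1(T(n_\lambda,n_\lambda,n_\lambda))>\lambda$, and $$m_{\lambda_2(G)}\le 2\,n_\lambda\,\Delta^{n_\lambda+3}\,(1+\Delta+\Delta^2).$$ -/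

import Mathlib

noncomputable section

namespace EigMult

/-- The real adjacency matrix of a finite simple graph is symmetric. -/
theorem adjMatrix_isHermitian {V : Type*} [Fintype V] [DecidableEq V] (G : SimpleGraph V)
    [DecidableRel G.Adj] : (G.adjMatrix ℝ).IsHermitian := by
  rw [Matrix.IsHermitian, Matrix.conjTranspose_eq_transpose_of_trivial]
  exact G.isSymm_adjMatrix

/-- The eigenvalues of the adjacency matrix, listed in decreasing order and repeated according to
multiplicity; the index starts at `0`. -/
def adjEigenvalue {V : Type*} [Fintype V] [DecidableEq V] (G : SimpleGraph V)
    [DecidableRel G.Adj] (k : Fin (Fintype.card V)) : ℝ :=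
  (adjMatrix_isHermitian G).eigenvalues₀ k

/-- The largest adjacency eigenvalue `λ₁(G)`. -/
def lambdaOne {V : Type*} [Fintype V] [DecidableEq V] [Nonempty V] (G : SimpleGraph V)
    [DecidableRel G.Adj] : ℝ :=
  adjEigenvalue G ⟨0, Fintype.card_pos⟩

/-- The second largest adjacency eigenvalue `λ₂(G)`, counted with multiplicity, of a graph with at
least two vertices. -/
def lambdaTwo {V : Type*} [Fintype V] [DecidableEq V] [Nontrivial V] (G : SimpleGraph V)
    [DecidableRel G.Adj] : ℝ :=
  adjEigenvalue G ⟨1, Fintype.one_lt_card⟩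

/-- The multiplicity of the real number `μ` as an eigenvalue of the adjacency matrix: the dimension
of its eigenspace. -/
def adjMultiplicity {V : Type*} [Fintype V] [DecidableEq V] (G : SimpleGraph V)
    [DecidableRel G.Adj] (μ : ℝ) : ℕ :=
  Module.finrank ℝ (Module.End.eigenspace (Matrix.toLin' (G.adjMatrix ℝ)) μ)

/-- Adjacency in the spider with three legs of length `n`. The vertex `none` is the center and
`some (i, j)` is the vertex at distance `j + 1` from the center on the leg `i`. -/
def spiderAdj (n : ℕ) : Option (Fin 3 × Fin n) → Option (Fin 3 × Fin n) → Prop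
  | none, none => False
  | none, some (_, j) => (j : ℕ) = 0
  | some (_, j), none => (j : ℕ) = 0
  | some (i, j), some (i', j') => i = i' ∧ ((j : ℕ) + 1 = j' ∨ (j' : ℕ) + 1 = j)

/-- The spider `T(n, n, n)`: three paths with `n` edges each that share exactly their initial
vertex. -/
def spider (n : ℕ) : SimpleGraph (Option (Fin 3 × Fin n)) where
  Adj := spiderAdj n
  symm := ⟨by
    rintro (_ | ⟨i, j⟩) (_ | ⟨i', j'⟩) h
    · exact h
    · exact h
    · exact h
    · exact ⟨h.1.symm, h.2.symm⟩⟩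
  loopless := ⟨by
    rintro (_ | ⟨i, j⟩) h
    · exact h
    · rcases h.2 with h | h <;> omega⟩

instance (n : ℕ) : DecidableRel (spider n).Adj
  | none, none => inferInstanceAs (Decidable False)
  | none, some (_, j) => inferInstanceAs (Decidable ((j : ℕ) = 0))
  | some (_, j), none => inferInstanceAs (Decidable ((j : ℕ) = 0))
  | some (i, j), some (i', j') =>
    inferInstanceAs (Decidable (i = i' ∧ ((j : ℕ) + 1 = j' ∨ (j' : ℕ) + 1 = j)))

/-- The positive integers `n` with `λ₁(T(n, n, n)) > l`. -/
def spiderSet (l : ℝ) : Set ℕ := {n | 1 ≤ n ∧ l < lambdaOne (spider n)}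

/-- The constant `n_l`: the least positive integer `n` with `λ₁(T(n, n, n)) > l`. -/
def nConst (l : ℝ) : ℕ := sInf (spiderSet l)

end EigMult

end

namespace EigMult

open Matrix Finset

/-! Write `μ = λ₂(G)`. The multiplicity bound rests on a propagation principle
(`adjMultiplicity_le_card`). Suppose that vectors vanishing on a nonempty set `X` have Rayleigh
quotient at most `μ`. If a `μ`-eigenvector `f` vanishes on a set `Y` containing `X` and its
neighbours, then `|f|` is a maximizer under this constraint, so zeros spread to neighbours and `f =
0` by connectedness. Restriction to `Y` is therefore injective on the eigenspace, and the
multiplicity is at most `#Y`.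

Such an `X` comes from `NonAdj.quadForm_le_lambdaTwo`: once one vector has quotient above `μ`, every
vector supported away from it has quotient at most `μ`. Put `n = n_l`.

If `G` contains `T(n,n,n)`, the Perron vector of the spider has quotient above `μ`. Take `X` to be
the closed neighbourhood of the copy; then `Y` has at most `(3n+1)(1+Δ+Δ²)` vertices.

Otherwise each distance level from a root has at most `2Δ^n` vertices, since three vertices of one
level with distinct `n`-th ancestors would yield a spider (`IsParent.spider_isContained`). Two
consecutive levels serve as `X` (`exists_level_quadForm_le`), and `Y` lies in four levels.

Existence of `n_l` follows from a geometric test vector on the spider, whose quotient approaches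
`3/√2`. -/

/-- The quadratic form of a Hermitian matrix in the coordinates of an orthonormal eigenbasis. -/
theorem dotProduct_mulVec_eq_sum_eigenvalues {n : Type*} [Fintype n] [DecidableEq n]
    {A : Matrix n n ℝ} (hA : A.IsHermitian) (f : n → ℝ) :
    f ⬝ᵥ A *ᵥ f = ∑ i, hA.eigenvalues i * (⇑(hA.eigenvectorBasis i) ⬝ᵥ f) ^ 2 := by
  have h := hA.eigenvectorBasis.sum_inner_mul_inner (WithLp.toLp 2 f) (WithLp.toLp 2 (A *ᵥ f))
  simp only [EuclideanSpace.inner_eq_star_dotProduct, star_trivial] at h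
  rw [dotProduct_comm, ← h]
  refine sum_congr rfl fun i _ => ?_
  have h1 : (A *ᵥ f) ⬝ᵥ ⇑(hA.eigenvectorBasis i)
      = hA.eigenvalues i * (⇑(hA.eigenvectorBasis i) ⬝ᵥ f) := by
    have hT : Aᵀ = A := by
      rw [← conjTranspose_eq_transpose_of_trivial]; exact hA
    rw [dotProduct_comm, dotProduct_mulVec, ← mulVec_transpose, hT, hA.mulVec_eigenvectorBasis,
      smul_dotProduct, smul_eq_mul]
  rw [h1]
  ring

theorem dotProduct_self_eq_sum_eigenvectorBasis {n : Type*} [Fintype n] [DecidableEq n]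
    {A : Matrix n n ℝ} (hA : A.IsHermitian) (f : n → ℝ) :
    f ⬝ᵥ f = ∑ i, (⇑(hA.eigenvectorBasis i) ⬝ᵥ f) ^ 2 := by
  have h := hA.eigenvectorBasis.sum_inner_mul_inner (WithLp.toLp 2 f) (WithLp.toLp 2 f)
  simp only [EuclideanSpace.inner_eq_star_dotProduct, star_trivial] at h
  rw [← h]
  refine sum_congr rfl fun i _ => ?_
  rw [dotProduct_comm f, sq]

/-! ### Rayleigh quotients, `λ₂`, and propagation of zeros of eigenvectors. -/

section Graph

/-- `NonAdj G f g` says that no vertex of the support of `f` is equal or adjacent to a vertex of the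
support of `g`. -/
def NonAdj {V : Type*} (G : SimpleGraph V) (f g : V → ℝ) : Prop :=
  ∀ v w, f v ≠ 0 → g w ≠ 0 → v ≠ w ∧ ¬ G.Adj v w

theorem NonAdj.symm {V : Type*} {G : SimpleGraph V} {f g : V → ℝ} (h : NonAdj G f g) :
    NonAdj G g f :=
  fun v w hv hw => ⟨(h w v hw hv).1.symm, fun e => (h w v hw hv).2 e.symm⟩

theorem NonAdj.dotProduct_eq_zero {V : Type*} [Fintype V] {G : SimpleGraph V} {f g : V → ℝ}
    (h : NonAdj G f g) : f ⬝ᵥ g = 0 := by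
  refine sum_eq_zero fun v _ => ?_
  by_contra hv
  exact (h v v (left_ne_zero_of_mul hv) (right_ne_zero_of_mul hv)).1 rfl

theorem NonAdj.dotProduct_add_smul {V : Type*} [Fintype V] {G : SimpleGraph V} {f g : V → ℝ}
    (h : NonAdj G f g) (s t : ℝ) :
    (s • f + t • g) ⬝ᵥ (s • f + t • g) = s ^ 2 * (f ⬝ᵥ f) + t ^ 2 * (g ⬝ᵥ g) := by
  simp only [add_dotProduct, dotProduct_add, smul_dotProduct, dotProduct_smul, smul_eq_mul,
    h.dotProduct_eq_zero, h.symm.dotProduct_eq_zero]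
  ring

theorem abs_dotProduct_abs {V : Type*} [Fintype V] (f : V → ℝ) :
    (fun v => |f v|) ⬝ᵥ (fun v => |f v|) = f ⬝ᵥ f := by
  simp [dotProduct]

variable {V : Type*} [Fintype V] (G : SimpleGraph V) [DecidableRel G.Adj]

/-- The quadratic form of the adjacency matrix. -/
def quadForm (f : V → ℝ) : ℝ := f ⬝ᵥ G.adjMatrix ℝ *ᵥ f

theorem quadForm_eq_sum (f : V → ℝ) :
    quadForm G f = ∑ v, ∑ w, if G.Adj v w then f v * f w else 0 := by
  simp only [quadForm, dotProduct, mulVec, SimpleGraph.adjMatrix_apply, mul_sum]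
  refine sum_congr rfl fun v _ => sum_congr rfl fun w _ => ?_
  split_ifs <;> simp

theorem quadForm_le_quadForm_abs (f : V → ℝ) : quadForm G f ≤ quadForm G (fun v => |f v|) := by
  rw [quadForm_eq_sum, quadForm_eq_sum]
  refine sum_le_sum fun v _ => sum_le_sum fun w _ => ?_
  split_ifs
  · rw [← abs_mul]; exact le_abs_self _
  · exact le_rfl

theorem quadForm_add_smul (f g : V → ℝ) (s t : ℝ) :
    quadForm G (s • f + t • g) =
      s ^ 2 * quadForm G f + 2 * (s * t) * (g ⬝ᵥ G.adjMatrix ℝ *ᵥ f) + t ^ 2 * quadForm G g := by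
  have h : f ⬝ᵥ G.adjMatrix ℝ *ᵥ g = g ⬝ᵥ G.adjMatrix ℝ *ᵥ f := by
    rw [dotProduct_mulVec, ← mulVec_transpose, SimpleGraph.transpose_adjMatrix, dotProduct_comm]
  simp only [quadForm, mulVec_add, mulVec_smul, add_dotProduct, dotProduct_add, smul_dotProduct,
    dotProduct_smul, smul_eq_mul, h]
  ring

variable {G}

theorem NonAdj.dotProduct_mulVec_eq_zero {f g : V → ℝ} (h : NonAdj G f g) :
    f ⬝ᵥ G.adjMatrix ℝ *ᵥ g = 0 := by
  refine sum_eq_zero fun v _ => ?_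
  rw [SimpleGraph.adjMatrix_mulVec_apply, mul_sum]
  refine sum_eq_zero fun w hw => ?_
  by_contra hv
  exact (h v w (left_ne_zero_of_mul hv) (right_ne_zero_of_mul hv)).2 (by simpa using hw)

theorem NonAdj.quadForm_add_smul {f g : V → ℝ} (h : NonAdj G f g) (s t : ℝ) :
    quadForm G (s • f + t • g) = s ^ 2 * quadForm G f + t ^ 2 * quadForm G g := by
  rw [EigMult.quadForm_add_smul, h.symm.dotProduct_mulVec_eq_zero]
  ring

variable (G) [DecidableEq V]

theorem quadForm_le_lambdaOne [Nonempty V] (f : V → ℝ) :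
    quadForm G f ≤ lambdaOne G * (f ⬝ᵥ f) := by
  have hA := adjMatrix_isHermitian G
  rw [quadForm, dotProduct_mulVec_eq_sum_eigenvalues hA,
    dotProduct_self_eq_sum_eigenvectorBasis hA, mul_sum]
  refine sum_le_sum fun i _ => mul_le_mul_of_nonneg_right ?_ (sq_nonneg _)
  exact hA.eigenvalues₀_antitone (Fin.mk_le_of_le_val (Nat.zero_le _))

theorem exists_quadForm_eq_lambdaOne [Nonempty V] :
    ∃ f : V → ℝ, f ≠ 0 ∧ quadForm G f = lambdaOne G * (f ⬝ᵥ f) := by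
  have hA := adjMatrix_isHermitian G
  let i : V := Fintype.equivOfCardEq (Fintype.card_fin _) ⟨0, Fintype.card_pos⟩
  refine ⟨⇑(hA.eigenvectorBasis i), fun h => ?_, ?_⟩
  · have := hA.eigenvectorBasis.orthonormal.ne_zero i
    exact this (by ext j; exact congrFun h j)
  · rw [quadForm, hA.mulVec_eigenvectorBasis, dotProduct_smul, smul_eq_mul]
    simp [IsHermitian.eigenvalues, i, lambdaOne, adjEigenvalue]

theorem exists_quadForm_le_lambdaTwo [Nontrivial V] :
    ∃ e : V → ℝ, ∀ f : V → ℝ, e ⬝ᵥ f = 0 → quadForm G f ≤ lambdaTwo G * (f ⬝ᵥ f) := by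
  have hA := adjMatrix_isHermitian G
  let i : V := Fintype.equivOfCardEq (Fintype.card_fin _) ⟨0, Fintype.card_pos⟩
  refine ⟨⇑(hA.eigenvectorBasis i), fun f hf => ?_⟩
  rw [quadForm, dotProduct_mulVec_eq_sum_eigenvalues hA,
    dotProduct_self_eq_sum_eigenvectorBasis hA, mul_sum]
  refine sum_le_sum fun j _ => ?_
  by_cases hj : j = i
  · rw [hj, hf]; simp
  refine mul_le_mul_of_nonneg_right (hA.eigenvalues₀_antitone ?_) (sq_nonneg _)
  rw [Fin.le_def]
  refine Nat.one_le_iff_ne_zero.2 fun h0 => hj ?_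
  rw [← Equiv.symm_apply_eq]
  exact Fin.ext h0

/-- Two vectors with non-adjacent supports cannot both have Rayleigh quotient above `λ₂`. -/
theorem NonAdj.quadForm_le_lambdaTwo [Nontrivial V] {f g : V → ℝ} (h : NonAdj G f g)
    (hg : lambdaTwo G * (g ⬝ᵥ g) < quadForm G g) :
    quadForm G f ≤ lambdaTwo G * (f ⬝ᵥ f) := by
  obtain ⟨e, he⟩ := exists_quadForm_le_lambdaTwo G
  by_contra! hf
  by_cases h0 : e ⬝ᵥ f = 0
  · exact hf.not_ge (he f h0)
  -- This combination is orthogonal to the top eigenvector `e`, yet the coefficient of `g` is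
  -- nonzero, so its quotient would exceed `λ₂`.
  have h1 := he ((e ⬝ᵥ g) • f + (-(e ⬝ᵥ f)) • g) (by
    simp only [dotProduct_add, dotProduct_smul, smul_eq_mul]; ring)
  rw [h.quadForm_add_smul, h.dotProduct_add_smul] at h1
  have h2 : 0 < (-(e ⬝ᵥ f)) ^ 2 := by rw [neg_sq]; exact sq_pos_of_ne_zero h0
  nlinarith [mul_pos h2 (sub_pos.2 hg), mul_nonneg (sq_nonneg (e ⬝ᵥ g)) (sub_pos.2 hf).le]

variable {G}

/-- If the quadratic form is at most `μ` on the vectors vanishing on the nonempty set `X`, then an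
eigenvector for `μ` that vanishes on a set containing `X` and its neighbours is zero. -/
theorem eq_zero_of_eigenvector_of_vanish (hconn : G.Connected) {μ : ℝ} {X Y : Finset V}
    (hX : X.Nonempty) (hXY : X ⊆ Y) (hY : ∀ v ∈ X, ∀ w, G.Adj v w → w ∈ Y)
    (hμ : ∀ f : V → ℝ, (∀ v ∈ X, f v = 0) → quadForm G f ≤ μ * (f ⬝ᵥ f))
    {f : V → ℝ} (hf : G.adjMatrix ℝ *ᵥ f = μ • f) (hfY : ∀ v ∈ Y, f v = 0) : f = 0 := by
  set g : V → ℝ := fun v => |f v| with hg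
  have hgX : ∀ v ∈ X, g v = 0 := fun v hv => by simp [hg, hfY v (hXY hv)]
  have hgQ : μ * (g ⬝ᵥ g) ≤ quadForm G g := by
    rw [hg, abs_dotProduct_abs]
    refine le_trans (le_of_eq ?_) (quadForm_le_quadForm_abs G f)
    rw [quadForm, hf, dotProduct_smul, smul_eq_mul]
  have key : ∀ v, g v = 0 → ∀ w, G.Adj v w → g w = 0 := by
    intro v hv w hvw
    by_cases hvX : v ∈ X
    · simp [hg, hfY w (hY v hvX w hvw)]
    -- First variation at a zero `v` outside `X`: testing `g + t • Pi.single v 1` gives `2 (A g) v ≤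
    -- μ t`, and `t = ε / (|μ| + 1)` makes the right side at most `ε`.
    have hsum : (G.adjMatrix ℝ *ᵥ g) v ≤ 0 := by
      refine le_of_forall_pos_le_add fun ε hε => ?_
      have ht : 0 < ε / (|μ| + 1) := by positivity
      set t := ε / (|μ| + 1) with ht'
      have h1 := hμ ((1 : ℝ) • g + t • Pi.single v 1) (fun x hx => by
        have : x ≠ v := fun e => hvX (e ▸ hx)
        simp [hgX x hx, this])
      have h2 : quadForm G (Pi.single v 1) = 0 := by
        simp [quadForm, single_dotProduct]
      have h3 : ((1 : ℝ) • g + t • Pi.single v 1) ⬝ᵥ ((1 : ℝ) • g + t • Pi.single v 1)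
          = g ⬝ᵥ g + t ^ 2 := by
        simp only [add_dotProduct, dotProduct_add, smul_dotProduct, dotProduct_smul, smul_eq_mul,
          single_dotProduct, dotProduct_single, Pi.add_apply, Pi.smul_apply, hv,
          Pi.single_eq_same]
        ring
      rw [quadForm_add_smul, h2, h3, single_dotProduct] at h1
      have h4 : 2 * (G.adjMatrix ℝ *ᵥ g) v ≤ μ * t := by
        refine le_of_mul_le_mul_left ?_ ht
        nlinarith
      have h5 : μ * t ≤ ε := by
        have : t * (|μ| + 1) = ε := by rw [ht']; field_simp
        nlinarith [le_abs_self μ]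
      linarith
    rw [SimpleGraph.adjMatrix_mulVec_apply] at hsum
    have hnn : ∀ u ∈ G.neighborFinset v, 0 ≤ g u := fun u _ => abs_nonneg _
    exact (sum_eq_zero_iff_of_nonneg hnn).1 (le_antisymm hsum (sum_nonneg hnn)) w (by simpa)
  obtain ⟨x, hx⟩ := hX
  ext v
  obtain ⟨p⟩ := hconn.preconnected x v
  have : ∀ {a b : V} (p : G.Walk a b), g a = 0 → g b = 0 := by
    intro a b p
    induction p with
    | nil => exact id
    | cons h _ ih => exact fun ha => ih (key _ ha _ h)
  simpa [hg] using this p (hgX x hx)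

theorem adjMultiplicity_le_card (hconn : G.Connected) {μ : ℝ} {X Y : Finset V}
    (hX : X.Nonempty) (hXY : X ⊆ Y) (hY : ∀ v ∈ X, ∀ w, G.Adj v w → w ∈ Y)
    (hμ : ∀ f : V → ℝ, (∀ v ∈ X, f v = 0) → quadForm G f ≤ μ * (f ⬝ᵥ f)) :
    adjMultiplicity G μ ≤ #Y := by
  let E := Module.End.eigenspace (Matrix.toLin' (G.adjMatrix ℝ)) μ
  let r : E →ₗ[ℝ] (Y → ℝ) := (LinearMap.funLeft ℝ ℝ (Subtype.val : Y → V)) ∘ₗ E.subtype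
  have hr : Function.Injective r := by
    rw [← LinearMap.ker_eq_bot, LinearMap.ker_eq_bot']
    rintro ⟨f, hf⟩ h
    have hf' := Module.End.mem_eigenspace_iff.1 hf
    rw [Matrix.toLin'_apply] at hf'
    exact Subtype.ext (eq_zero_of_eigenvector_of_vanish hconn hX hXY hY hμ hf'
      fun v hv => congrFun h ⟨v, hv⟩)
  simpa [adjMultiplicity, E] using LinearMap.finrank_le_finrank_of_injective hr

end Graph

end EigMult

/-! ### Finding spiders in a graph with levels and bounding the size of levels. -/

namespace EigMult

open Finset

/-- Three paths with `n` edges that share exactly their initial vertex form a spider. -/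
theorem spider_isContained_of_legs {V : Type*} {G : SimpleGraph V} {n : ℕ} {z : V} {a b c : ℕ → V}
    (ha : a 0 = z) (hb : b 0 = z) (hc : c 0 = z)
    (ha' : ∀ j < n, G.Adj (a j) (a (j + 1))) (hb' : ∀ j < n, G.Adj (b j) (b (j + 1)))
    (hc' : ∀ j < n, G.Adj (c j) (c (j + 1)))
    (iaa : ∀ i ≤ n, ∀ j ≤ n, a i = a j → i = j) (ibb : ∀ i ≤ n, ∀ j ≤ n, b i = b j → i = j)
    (icc : ∀ i ≤ n, ∀ j ≤ n, c i = c j → i = j)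
    (iab : ∀ i ≤ n, ∀ j ≤ n, 1 ≤ i → 1 ≤ j → a i ≠ b j)
    (iac : ∀ i ≤ n, ∀ j ≤ n, 1 ≤ i → 1 ≤ j → a i ≠ c j)
    (ibc : ∀ i ≤ n, ∀ j ≤ n, 1 ≤ i → 1 ≤ j → b i ≠ c j) :
    (spider n).IsContained G := by
  let leg : Fin 3 → ℕ → V := ![a, b, c]
  have leg_zero : ∀ i, leg i 0 = z := by
    intro i; fin_cases i <;> assumption
  have leg_adj : ∀ i, ∀ j < n, G.Adj (leg i j) (leg i (j + 1)) := by
    intro i; fin_cases i <;> assumption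
  have leg_inj : ∀ i, ∀ j ≤ n, ∀ k ≤ n, leg i j = leg i k → j = k := by
    intro i; fin_cases i <;> assumption
  have leg_ne : ∀ i i', i ≠ i' → ∀ j ≤ n, ∀ k ≤ n, 1 ≤ j → 1 ≤ k → leg i j ≠ leg i' k := by
    intro i i' h j hj k hk hj1 hk1
    fin_cases i <;> fin_cases i'
    · exact absurd rfl h
    · exact iab j hj k hk hj1 hk1
    · exact iac j hj k hk hj1 hk1
    · exact (iab k hk j hj hk1 hj1).symm
    · exact absurd rfl h
    · exact ibc j hj k hk hj1 hk1
    · exact (iac k hk j hj hk1 hj1).symm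
    · exact (ibc k hk j hj hk1 hj1).symm
    · exact absurd rfl h
  let φ : Option (Fin 3 × Fin n) → V
    | none => z
    | some (i, j) => leg i (j + 1)
  have φ_ne : ∀ i (j : Fin n), leg i (j + 1) ≠ z := fun i j h => by
    rw [← leg_zero i] at h
    have := leg_inj i _ (by omega) _ (by omega) h
    omega
  refine ⟨⟨⟨φ, ?_⟩, ?_⟩⟩
  · rintro (_ | ⟨i, j⟩) (_ | ⟨i', j'⟩) h
    · exact h.elim
    · have h0 : (j' : ℕ) = 0 := h
      have := leg_adj i' 0 (by omega)
      simpa [φ, h0, leg_zero] using this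
    · have h0 : (j : ℕ) = 0 := h
      have := (leg_adj i 0 (by omega)).symm
      simpa [φ, h0, leg_zero] using this
    · obtain ⟨rfl, h | h⟩ := (h : i = i' ∧ ((j : ℕ) + 1 = j' ∨ (j' : ℕ) + 1 = j))
      · have := leg_adj i (j + 1) (by omega)
        simpa [φ, ← h] using this
      · have := (leg_adj i (j' + 1) (by omega)).symm
        simpa [φ, ← h] using this
  · rintro (_ | ⟨i, j⟩) (_ | ⟨i', j'⟩) h
    · rfl
    · exact (φ_ne i' j' h.symm).elim
    · exact (φ_ne i j h).elim
    · change leg i (j + 1) = leg i' (j' + 1) at h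
      by_cases hi : i = i'
      · subst hi
        have := leg_inj i _ (by omega) _ (by omega) h
        have hj : j = j' := Fin.ext (by omega)
        rw [hj]
      · exact (leg_ne i i' hi _ (by omega) _ (by omega) (by omega) (by omega) h).elim

/-- A parent function `p` for a level function `lvl` with a single vertex of level `0`. -/
structure IsParent {V : Type*} (G : SimpleGraph V) (lvl : V → ℕ) (p : V → V) : Prop where
  root : ∀ v w, lvl v = 0 → lvl w = 0 → v = w
  adj : ∀ v, lvl v ≠ 0 → G.Adj v (p v)
  lvl_add_one : ∀ v, lvl v ≠ 0 → lvl (p v) + 1 = lvl v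

theorem exists_isParent_dist {V : Type*} {G : SimpleGraph V} (hconn : G.Connected) (u : V) :
    ∃ p, IsParent G (G.dist u) p := by
  have h : ∀ v, ∃ w, G.dist u v ≠ 0 → G.Adj v w ∧ G.dist u w + 1 = G.dist u v := by
    intro v
    obtain ⟨q, hq⟩ := hconn.exists_walk_length_eq_dist v u
    rw [SimpleGraph.dist_comm] at hq
    cases q with
    | nil => exact ⟨u, fun h => (h (by simp)).elim⟩
    | @cons _ w _ hvw q =>
      refine ⟨w, fun _ => ⟨hvw, ?_⟩⟩
      have h1 : G.dist u w ≤ q.length := by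
        rw [SimpleGraph.dist_comm]; exact SimpleGraph.dist_le q
      have h2 : G.dist u v ≤ G.dist u w + 1 := by
        have := hconn.dist_triangle (u := u) (v := w) (w := v)
        rwa [SimpleGraph.dist_eq_one_iff_adj.2 hvw.symm] at this
      rw [SimpleGraph.Walk.length_cons] at hq
      omega
  choose p hp using h
  refine ⟨p, ?_, fun v hv => (hp v hv).1, fun v hv => (hp v hv).2⟩
  intro v w hv hw
  rw [← hconn.dist_eq_zero_iff.1 hv, ← hconn.dist_eq_zero_iff.1 hw]

namespace IsParent

variable {V : Type*} {G : SimpleGraph V} {lvl : V → ℕ} {p : V → V} (hp : IsParent G lvl p)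
include hp

theorem lvl_iterate_add {v : V} {t : ℕ} (ht : t ≤ lvl v) : lvl (p^[t] v) + t = lvl v := by
  induction t with
  | zero => rfl
  | succ t ih =>
    rw [Function.iterate_succ_apply']
    have h1 := ih (by omega)
    have h2 := hp.lvl_add_one (p^[t] v) (by omega)
    omega

theorem adj_iterate {v : V} {t : ℕ} (ht : t < lvl v) : G.Adj (p^[t] v) (p^[t + 1] v) := by
  rw [Function.iterate_succ_apply']
  have := hp.lvl_iterate_add ht.le
  exact hp.adj _ (by omega)

theorem iterate_eq_imp {v w : V} {k s t : ℕ} (hv : lvl v = k) (hw : lvl w = k) (hs : s ≤ k)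
    (ht : t ≤ k) (h : p^[s] v = p^[t] w) : s = t := by
  have h1 := hp.lvl_iterate_add (hv.symm ▸ hs)
  have h2 := hp.lvl_iterate_add (hw.symm ▸ ht)
  rw [h] at h1
  omega

/-- The centre is the vertex where the ancestor chains of `x` and `y` merge. Two legs descend
towards `x` and `y`; the third climbs to the meeting point with the chain of `w` and then descends
towards `w`. Since levels determine the number of steps, chains can meet only at equal step counts,
which gives disjointness. -/
theorem spider_isContained_of_merge {x y w : V} {k n m₁ m₂ : ℕ} (hx : lvl x = k) (hy : lvl y = k)
    (hw : lvl w = k) (hn : n ≤ m₁) (hm : m₁ ≤ m₂) (hk : m₂ ≤ k)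
    (exy : p^[m₁] x = p^[m₁] y) (exw : p^[m₂] x = p^[m₂] w)
    (nxy : ∀ t < m₁, p^[t] x ≠ p^[t] y) (nxw : ∀ t < m₂, p^[t] x ≠ p^[t] w)
    (nyw : ∀ t < m₂, p^[t] y ≠ p^[t] w) : (spider n).IsContained G := by
  have down : ∀ v, lvl v = k → ∀ m, ∀ j < m, m - (j + 1) < k →
      G.Adj (p^[m - j] v) (p^[m - (j + 1)] v) := by
    intro v hv m j hj hm
    have := (hp.adj_iterate (v := v) (t := m - (j + 1)) (by omega)).symm
    rwa [show m - (j + 1) + 1 = m - j by omega] at this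
  refine spider_isContained_of_legs (z := p^[m₁] x) (a := fun j => p^[m₁ - j] x)
    (b := fun j => p^[m₁ - j] y)
    -- The climb takes `m₂ - m₁` edges; afterwards the leg is `m₂ - (j - (m₂ - m₁))` steps above
    -- `w`.
    (c := fun j => if j ≤ m₂ - m₁ then p^[m₁ + j] x else p^[2 * m₂ - m₁ - j] w)
    rfl exy.symm (by simp) ?_ ?_ ?_ ?_ ?_ ?_ ?_ ?_ ?_
  · exact fun j hj => down x hx m₁ j (by omega) (by omega)
  · exact fun j hj => down y hy m₁ j (by omega) (by omega)
  · intro j hj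
    rcases lt_trichotomy j (m₂ - m₁) with h | h | h
    · rw [if_pos (by omega), if_pos (by omega)]
      exact hp.adj_iterate (by omega)
    · rw [if_pos (by omega), if_neg (by omega), show m₁ + j = m₂ by omega, exw,
        show 2 * m₂ - m₁ - (j + 1) = m₂ - (0 + 1) by omega]
      exact down w hw m₂ 0 (by omega) (by omega)
    · rw [if_neg (by omega), if_neg (by omega)]
      exact down w hw (2 * m₂ - m₁) j (by omega) (by omega)
  · intro i hi j hj h
    have := hp.iterate_eq_imp hx hx (by omega) (by omega) h
    omega
  · intro i hi j hj h
    have := hp.iterate_eq_imp hy hy (by omega) (by omega) h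
    omega
  · intro i hi j hj h
    split_ifs at h with h1 h2 h2
    · have := hp.iterate_eq_imp hx hx (by omega) (by omega) h
      omega
    · have e := hp.iterate_eq_imp hx hw (by omega) (by omega) h
      rw [← e] at h
      exact (nxw _ (by omega) h).elim
    · have e := hp.iterate_eq_imp hw hx (by omega) (by omega) h
      rw [e] at h
      exact (nxw _ (by omega) h.symm).elim
    · have := hp.iterate_eq_imp hw hw (by omega) (by omega) h
      omega
  · intro i hi j hj hi1 hj1 h
    have e := hp.iterate_eq_imp hx hy (by omega) (by omega) h
    rw [← e] at h
    exact nxy _ (by omega) h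
  · intro i hi j hj hi1 hj1 h
    split_ifs at h with h1
    · have := hp.iterate_eq_imp hx hx (by omega) (by omega) h
      omega
    · have e := hp.iterate_eq_imp hx hw (by omega) (by omega) h
      rw [← e] at h
      exact nxw _ (by omega) h
  · intro i hi j hj hi1 hj1 h
    split_ifs at h with h1
    · have := hp.iterate_eq_imp hy hx (by omega) (by omega) h
      omega
    · have e := hp.iterate_eq_imp hy hw (by omega) (by omega) h
      rw [← e] at h
      exact nyw _ (by omega) h

theorem exists_merge {x y : V} {k n : ℕ} (hx : lvl x = k) (hy : lvl y = k)
    (hne : p^[n] x ≠ p^[n] y) :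
    ∃ m ≤ k, n ≤ m ∧ (∀ t, p^[t] x = p^[t] y ↔ m ≤ t) := by
  classical
  have mono : ∀ s t, s ≤ t → p^[s] x = p^[s] y → p^[t] x = p^[t] y := by
    intro s t hst h
    obtain ⟨d, rfl⟩ := Nat.exists_eq_add_of_le' hst
    rw [Function.iterate_add_apply, Function.iterate_add_apply, h]
  have hk : p^[k] x = p^[k] y := by
    have h1 := hp.lvl_iterate_add hx.ge
    have h2 := hp.lvl_iterate_add hy.ge
    exact hp.root _ _ (by omega) (by omega)
  have hex : ∃ t, p^[t] x = p^[t] y := ⟨k, hk⟩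
  refine ⟨Nat.find hex, Nat.find_min' hex hk, ?_, fun t =>
    ⟨fun h => Nat.find_min' hex h, fun h => mono _ _ h (Nat.find_spec hex)⟩⟩
  by_contra! h
  exact hne (mono _ _ h.le (Nat.find_spec hex))

/-- Three vertices of the same level whose `n`-th ancestors are distinct give a spider. -/
theorem spider_isContained {x y w : V} {k n : ℕ} (hx : lvl x = k) (hy : lvl y = k)
    (hw : lvl w = k) (hxy : p^[n] x ≠ p^[n] y) (hxw : p^[n] x ≠ p^[n] w)
    (hyw : p^[n] y ≠ p^[n] w) : (spider n).IsContained G := by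
  have core : ∀ {x y w : V} {a b c : ℕ}, lvl x = k → lvl y = k → lvl w = k → n ≤ a → b ≤ k →
      (∀ t, p^[t] x = p^[t] y ↔ a ≤ t) → (∀ t, p^[t] x = p^[t] w ↔ b ≤ t) →
      (∀ t, p^[t] y = p^[t] w ↔ c ≤ t) → a ≤ b → a ≤ c → (spider n).IsContained G := by
    intro x y w a b c hx hy hw hna hbk ha hb hc hab hac
    -- Once `x` and `y` have merged they share all ancestors, so both meet `w` at the same step.
    -- Hence the two larger merging times agree, and the case split below only selects the pair that
    -- merges earliest.
    have hbc : b = c := by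
      apply le_antisymm
      · rw [← hb, (ha c).2 hac]; exact (hc c).2 le_rfl
      · rw [← hc, ← (ha b).2 hab]; exact (hb b).2 le_rfl
    subst hbc
    exact hp.spider_isContained_of_merge hx hy hw hna hab hbk ((ha a).2 le_rfl) ((hb b).2 le_rfl)
      (fun t ht h => ht.not_ge ((ha t).1 h)) (fun t ht h => ht.not_ge ((hb t).1 h))
      (fun t ht h => ht.not_ge ((hc t).1 h))
  obtain ⟨a, hak, hna, ha⟩ := hp.exists_merge hx hy hxy
  obtain ⟨b, hbk, hnb, hb⟩ := hp.exists_merge hx hw hxw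
  obtain ⟨c, hck, hnc, hc⟩ := hp.exists_merge hy hw hyw
  have ha' : ∀ t, p^[t] y = p^[t] x ↔ a ≤ t := fun t => by rw [eq_comm, ha]
  have hb' : ∀ t, p^[t] w = p^[t] x ↔ b ≤ t := fun t => by rw [eq_comm, hb]
  have hc' : ∀ t, p^[t] w = p^[t] y ↔ c ≤ t := fun t => by rw [eq_comm, hc]
  rcases le_total a b with h1 | h1
  · rcases le_total a c with h2 | h2
    · exact core hx hy hw hna hbk ha hb hc h1 h2
    · exact core hy hw hx hnc hak hc ha' hb' h2 (h2.trans h1)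
  · rcases le_total b c with h2 | h2
    · exact core hx hw hy hnb hak hb ha hc' h1 h2
    · exact core hy hw hx hnc hak hc ha' hb' (h2.trans h1) h2

variable [Fintype V] [DecidableEq V] [DecidableRel G.Adj]

/-- A vertex with parent `a` is a neighbour of `a`, so each generation of descendants grows by a
factor of at most the maximum degree. -/
theorem card_fiber_le (t : ℕ) (a : V) : #{w | t ≤ lvl w ∧ p^[t] w = a} ≤ G.maxDegree ^ t := by
  induction t generalizing a with
  | zero =>
    refine (card_le_card (t := {a}) fun w hw => ?_).trans (by simp)
    simpa using hw
  | succ t ih =>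
    have hsub : ({w | t + 1 ≤ lvl w ∧ p^[t + 1] w = a} : Finset V) ⊆
        (G.neighborFinset a).biUnion fun b => {w | t ≤ lvl w ∧ p^[t] w = b} := by
      intro w hw
      simp only [mem_filter, mem_univ, true_and] at hw
      have := hp.adj_iterate (v := w) (t := t) (by omega)
      rw [hw.2] at this
      simp only [mem_biUnion, SimpleGraph.mem_neighborFinset, mem_filter, mem_univ, true_and]
      exact ⟨_, this.symm, by omega, rfl⟩
    calc _ ≤ _ := card_le_card hsub
      _ ≤ #(G.neighborFinset a) * G.maxDegree ^ t := card_biUnion_le_card_mul _ _ _ fun b _ => ih b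
      _ ≤ G.maxDegree * G.maxDegree ^ t :=
        Nat.mul_le_mul_right _ (G.degree_le_maxDegree a)
      _ = _ := by ring

theorem card_level_le_pow (k : ℕ) : #{w | lvl w = k} ≤ G.maxDegree ^ k := by
  rcases ({w | lvl w = k} : Finset V).eq_empty_or_nonempty with h | ⟨v, hv⟩
  · simp [h]
  refine (card_le_card fun w hw => ?_).trans (hp.card_fiber_le k (p^[k] v))
  simp only [mem_filter, mem_univ, true_and] at hv hw ⊢
  have h1 := hp.lvl_iterate_add hv.ge
  have h2 := hp.lvl_iterate_add hw.ge
  exact ⟨hw.ge, hp.root _ _ (by omega) (by omega)⟩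

theorem card_level_le {n : ℕ} (hd : 1 ≤ G.maxDegree) (hG : ¬ (spider n).IsContained G) (k : ℕ) :
    #{w | lvl w = k} ≤ 2 * G.maxDegree ^ n := by
  rcases lt_or_ge k n with hk | hk
  · calc _ ≤ _ := hp.card_level_le_pow k
      _ ≤ G.maxDegree ^ n := Nat.pow_le_pow_right hd hk.le
      _ ≤ _ := by omega
  have hA : #(({w | lvl w = k} : Finset V).image p^[n]) ≤ 2 := by
    by_contra! h
    obtain ⟨a, b, c, ha, hb, hc, hab, hac, hbc⟩ := two_lt_card_iff.1 h
    simp only [mem_image, mem_filter, mem_univ, true_and] at ha hb hc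
    obtain ⟨x, hx, rfl⟩ := ha
    obtain ⟨y, hy, rfl⟩ := hb
    obtain ⟨w, hw, rfl⟩ := hc
    exact hG (hp.spider_isContained hx hy hw hab hac hbc)
  calc _ ≤ G.maxDegree ^ n * #(({w | lvl w = k} : Finset V).image p^[n]) := by
        refine card_le_mul_card_image _ _ fun a _ => ?_
        refine (card_le_card fun w hw => ?_).trans (hp.card_fiber_le n a)
        simp only [mem_filter, mem_univ, true_and] at hw ⊢
        exact ⟨hw.1 ▸ hk, hw.2⟩
    _ ≤ G.maxDegree ^ n * 2 := Nat.mul_le_mul_left _ hA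
    _ = _ := by ring

end IsParent

end EigMult

namespace EigMult

open Matrix Finset

/-! ### Spiders with largest eigenvalue above any number less than `3/√2`. -/

section Rayleigh

theorem le_adjMatrix_mulVec_of_subset {V : Type*} [Fintype V] {G : SimpleGraph V}
    [DecidableRel G.Adj] {f : V → ℝ} (hf : ∀ v, 0 ≤ f v) {v : V} {s : Finset V}
    (hs : ∀ w ∈ s, G.Adj v w) : ∑ w ∈ s, f w ≤ (G.adjMatrix ℝ *ᵥ f) v := by
  rw [SimpleGraph.adjMatrix_mulVec_apply]
  exact sum_le_sum_of_subset_of_nonneg (fun w hw => by simpa using hs w hw) fun w _ _ => hf w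

/-- The geometrically decaying vector on the spider. -/
def spiderVec (r : ℝ) (n : ℕ) : Option (Fin 3 × Fin n) → ℝ
  | none => 1
  | some (_, j) => r ^ ((j : ℕ) + 1)

/-- For `r² = 1/2` the decaying vector satisfies the eigenvalue equation for `3r` at the centre and
along infinite legs. Truncation drops only the term `r^(m+1) * r^(m+2)` at each of the three leaves.
-/
theorem quadForm_spiderVec_ge {r : ℝ} (hr : 0 ≤ r) (hr2 : r ^ 2 = 1 / 2) (m : ℕ) :
    3 * r * (spiderVec r (m + 1) ⬝ᵥ spiderVec r (m + 1)) - 3 * r ^ (2 * m + 3) ≤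
      quadForm (spider (m + 1)) (spiderVec r (m + 1)) := by
  set f := spiderVec r (m + 1) with hf
  have f_nonneg : ∀ v, 0 ≤ f v := by
    rintro (_ | ⟨i, j⟩)
    · exact zero_le_one
    · exact pow_nonneg hr _
  let loss : Option (Fin 3 × Fin (m + 1)) → ℝ
    | none => 0
    | some (_, j) => if j = Fin.last m then r ^ (2 * m + 3) else 0
  have hloss : ∑ v, loss v = 3 * r ^ (2 * m + 3) := by
    rw [Fintype.sum_option, Fintype.sum_prod_type]
    simp [loss]
  have hpt : ∀ v, 3 * r * (f v * f v) - loss v ≤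
      f v * ((spider (m + 1)).adjMatrix ℝ *ᵥ f) v := by
    rintro (_ | ⟨i, j⟩)
    · have h := le_adjMatrix_mulVec_of_subset (G := spider (m + 1)) f_nonneg (v := none)
        (s := univ.image fun i : Fin 3 => some (i, 0)) (by
          intro w hw
          obtain ⟨i, -, rfl⟩ := mem_image.1 hw
          exact (rfl : ((0 : Fin (m + 1)) : ℕ) = 0))
      rw [sum_image (by intro a _ b _ h; simpa using h)] at h
      simpa [hf, spiderVec, loss] using h
    · let w : Option (Fin 3 × Fin (m + 1)) :=
        if h : (j : ℕ) = 0 then none else some (i, ⟨j - 1, by omega⟩)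
      have hw : f w = r ^ (j : ℕ) := by
        by_cases h : (j : ℕ) = 0
        · simp [w, h, hf, spiderVec]
        · simp [w, h, hf, spiderVec, Nat.sub_add_cancel (Nat.one_le_iff_ne_zero.2 h)]
      have hadj : (spider (m + 1)).Adj (some (i, j)) w := by
        by_cases h : (j : ℕ) = 0
        · simp only [w, dif_pos h]
          exact h
        · simp only [w, dif_neg h]
          exact ⟨rfl, Or.inr (Nat.sub_add_cancel (Nat.one_le_iff_ne_zero.2 h))⟩
      have hfj : f (some (i, j)) = r ^ ((j : ℕ) + 1) := rfl
      have hrec : 3 * r * r ^ ((j : ℕ) + 1) = r ^ (j : ℕ) + r ^ ((j : ℕ) + 2) := by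
        linear_combination (2 * r ^ (j : ℕ)) * hr2
      by_cases hj : j = Fin.last m
      · have h := le_adjMatrix_mulVec_of_subset (G := spider (m + 1)) f_nonneg
          (v := some (i, j)) (s := {w}) (by simpa using hadj)
        rw [sum_singleton, hw] at h
        have h1 := mul_le_mul_of_nonneg_left h (f_nonneg (some (i, j)))
        refine le_trans (le_of_eq ?_) h1
        have hjm : (j : ℕ) = m := by simp [hj]
        simp only [loss, if_pos hj, hfj]
        rw [hjm] at hrec ⊢
        linear_combination r ^ (m + 1) * hrec
      · have hj1 : (j : ℕ) + 1 < m + 1 := by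
          have : (j : ℕ) ≠ m := fun h => hj (Fin.ext h)
          omega
        have hne : w ≠ some (i, ⟨j + 1, hj1⟩) := by
          intro h
          by_cases h0 : (j : ℕ) = 0
          · simp [w, h0] at h
          · simp only [w, dif_neg h0, Option.some.injEq, Prod.mk.injEq, true_and,
              Fin.mk.injEq] at h
            omega
        have h := le_adjMatrix_mulVec_of_subset (G := spider (m + 1)) f_nonneg
          (v := some (i, j)) (s := {w, some (i, ⟨j + 1, hj1⟩)}) (by
            intro x hx
            rcases mem_insert.1 hx with rfl | hx
            · exact hadj
            · rw [mem_singleton.1 hx]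
              exact ⟨rfl, Or.inl rfl⟩)
        rw [sum_pair hne, hw] at h
        have h1 := mul_le_mul_of_nonneg_left h (f_nonneg (some (i, j)))
        refine le_trans (le_of_eq ?_) h1
        simp only [loss, if_neg hj, hfj]
        have h2 : f (some (i, ⟨j + 1, hj1⟩)) = r ^ ((j : ℕ) + 2) := rfl
        rw [h2]
        linear_combination r ^ ((j : ℕ) + 1) * hrec
  rw [quadForm, dotProduct, dotProduct, mul_sum, ← hloss, ← sum_sub_distrib]
  exact sum_le_sum fun v _ => hpt v

theorem spiderSet_nonempty {l : ℝ} (hl : l < 3 / √2) : (spiderSet l).Nonempty := by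
  set r : ℝ := (√2)⁻¹ with hr
  have hr0 : 0 ≤ r := by positivity
  have hr2 : r ^ 2 = 1 / 2 := by rw [hr, inv_pow, Real.sq_sqrt (by norm_num)]; norm_num
  have hr1 : r < 1 := by nlinarith
  obtain ⟨m, hm⟩ := exists_pow_lt_of_lt_one (show 0 < (3 / √2 - l) / 3 by linarith) hr1
  refine ⟨m + 1, by omega, ?_⟩
  have h1 := quadForm_spiderVec_ge hr0 hr2 m
  have h2 := quadForm_le_lambdaOne (spider (m + 1)) (spiderVec r (m + 1))
  have h3 : 1 ≤ spiderVec r (m + 1) ⬝ᵥ spiderVec r (m + 1) := by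
    rw [dotProduct, Fintype.sum_option]
    have : 0 ≤ ∑ i, spiderVec r (m + 1) (some i) * spiderVec r (m + 1) (some i) :=
      sum_nonneg fun i _ => mul_self_nonneg _
    simpa [spiderVec] using this
  have h4 : r ^ (2 * m + 3) ≤ r ^ m := pow_le_pow_of_le_one hr0 hr1.le (by omega)
  have h5 : 3 / √2 = 3 * r := by rw [hr, div_eq_mul_inv]
  by_contra! h
  have h6 : (3 * r - l) * (spiderVec r (m + 1) ⬝ᵥ spiderVec r (m + 1)) ≤ 3 * r ^ (2 * m + 3) := by
    nlinarith
  rw [h5] at hm hl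
  nlinarith

end Rayleigh

/-! ### Multiplicity bound when `G` contains a graph with `λ₁ > λ₂(G)`. -/

section Copy

variable {V W : Type*} [Fintype V] [DecidableEq V] [Fintype W] [DecidableEq W]
  {G : SimpleGraph V} [DecidableRel G.Adj] {H : SimpleGraph W} [DecidableRel H.Adj]

/-- A graph contained in `G` yields a vector on `G`, supported on the copy, whose Rayleigh quotient
is at least the largest eigenvalue of the contained graph. -/
theorem exists_quadForm_ge_of_copy [Nonempty W] (φ : SimpleGraph.Copy H G) :
    ∃ g : V → ℝ, (∀ v, g v ≠ 0 → ∃ x, φ x = v) ∧ 0 < g ⬝ᵥ g ∧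
      lambdaOne H * (g ⬝ᵥ g) ≤ quadForm G g := by
  obtain ⟨e, he0, he⟩ := exists_quadForm_eq_lambdaOne H
  have hφ : Function.Injective φ := φ.injective'
  -- The copy need not be induced; absolute values ensure that extra edges of `G` only increase the
  -- quadratic form.
  let g : V → ℝ := Function.extend φ (fun x => |e x|) 0
  have hgφ : ∀ x, g (φ x) = |e x| := fun x => hφ.extend_apply _ _ x
  have hg0 : ∀ v, v ∉ Set.range φ → g v = 0 := fun v hv =>
    Function.extend_apply' _ _ v (by simpa using hv)
  have hgg : g ⬝ᵥ g = e ⬝ᵥ e := by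
    refine (Fintype.sum_of_injective φ hφ _ _ (fun v hv => by simp [hg0 v hv]) fun x => ?_).symm
    rw [hgφ, abs_mul_abs_self]
  refine ⟨g, fun v hv => ?_, ?_, ?_⟩
  · by_contra h
    exact hv (hg0 v h)
  · rw [hgg]
    refine lt_of_le_of_ne (sum_nonneg fun i _ => mul_self_nonneg _) fun h => he0 ?_
    exact dotProduct_self_eq_zero.1 h.symm
  · rw [hgg, ← he]
    refine (quadForm_le_quadForm_abs H e).trans ?_
    rw [quadForm_eq_sum, quadForm_eq_sum]
    calc _ ≤ ∑ x, ∑ w, (if G.Adj (φ x) w then g (φ x) * g w else 0) := by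
          refine sum_le_sum fun x _ => ?_
          rw [← Fintype.sum_of_injective φ hφ
            (fun y => if G.Adj (φ x) (φ y) then g (φ x) * g (φ y) else 0) _
            (fun v hv => by simp [hg0 v hv]) (fun y => rfl)]
          refine sum_le_sum fun y _ => ?_
          rw [hgφ, hgφ]
          by_cases hxy : H.Adj x y
          · rw [if_pos hxy, if_pos (show G.Adj (φ x) (φ y) from φ.toHom.map_adj hxy)]
          · rw [if_neg hxy]
            split_ifs <;> positivity
      _ ≤ _ := by
          rw [← Fintype.sum_of_injective φ hφ _
            (fun v => ∑ w, (if G.Adj v w then g v * g w else 0))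
            (fun v hv => by simp [hg0 v hv]) (fun y => rfl)]

theorem card_biUnion_neighborFinset_le (s : Finset V) :
    #(s.biUnion fun v => G.neighborFinset v) ≤ #s * G.maxDegree :=
  card_biUnion_le_card_mul _ _ _ fun v _ => G.degree_le_maxDegree v

theorem adjMultiplicity_lambdaTwo_le_of_copy [Nontrivial V] [Nonempty W] (hconn : G.Connected)
    (φ : SimpleGraph.Copy H G) (hH : lambdaTwo G < lambdaOne H) :
    adjMultiplicity G (lambdaTwo G) ≤
      Fintype.card W * (1 + G.maxDegree + G.maxDegree ^ 2) := by
  obtain ⟨g, hgφ, hg0, hg⟩ := exists_quadForm_ge_of_copy φ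
  let N : Finset V → Finset V := fun s => s.biUnion fun v => G.neighborFinset v
  let S : Finset V := univ.image φ
  let X := S ∪ N S
  have hS : ∀ v, g v ≠ 0 → v ∈ S := fun v hv => by
    obtain ⟨x, rfl⟩ := hgφ v hv
    exact mem_image_of_mem _ (mem_univ _)
  have hle : adjMultiplicity G (lambdaTwo G) ≤ #(X ∪ N (N S)) := by
    refine adjMultiplicity_le_card hconn (X := X) ?_ subset_union_left ?_ ?_
    · exact (univ_nonempty.image φ).mono subset_union_left
    · intro v hv w hvw
      rcases mem_union.1 hv with hv | hv
      · exact mem_union_left _ (mem_union_right _ (mem_biUnion.2 ⟨v, hv, by simpa⟩))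
      · exact mem_union_right _ (mem_biUnion.2 ⟨v, hv, by simpa⟩)
    · intro f hf
      refine NonAdj.quadForm_le_lambdaTwo G (g := g) (fun v w hv hw => ⟨?_, fun h => ?_⟩)
        (lt_of_lt_of_le (mul_lt_mul_of_pos_right hH hg0) hg)
      · rintro rfl
        exact hv (hf v (mem_union_left _ (hS v hw)))
      · exact hv (hf v (mem_union_right _ (mem_biUnion.2 ⟨w, hS w hw, by simpa using h.symm⟩)))
  have h1 : #S ≤ Fintype.card W := card_image_le
  have h2 : #(N S) ≤ #S * G.maxDegree := card_biUnion_neighborFinset_le S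
  have h3 : #(N (N S)) ≤ #(N S) * G.maxDegree := card_biUnion_neighborFinset_le (N S)
  calc _ ≤ _ := hle
    _ ≤ #S + #(N S) + #(N (N S)) :=
      (card_union_le _ _).trans (Nat.add_le_add_right (card_union_le _ _) _)
    _ ≤ #S + #S * G.maxDegree + #S * G.maxDegree * G.maxDegree := by
      gcongr
      exact h3.trans (Nat.mul_le_mul_right _ h2)
    _ = #S * (1 + G.maxDegree + G.maxDegree ^ 2) := by ring
    _ ≤ _ := Nat.mul_le_mul_right _ h1

end Copy

/-! ### Multiplicity bound from the sizes of the distance levels. -/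

section Levels

variable {V : Type*} [Fintype V] [DecidableEq V] [Nontrivial V] {G : SimpleGraph V}
  [DecidableRel G.Adj] {lvl : V → ℕ}

/-- Deleting two suitable consecutive levels leaves a graph whose largest eigenvalue is at most
`λ₂(G)`. -/
theorem exists_level_quadForm_le (hadj : ∀ v w, G.Adj v w → lvl w ≤ lvl v + 1) :
    ∃ i, ∀ f : V → ℝ, (∀ v, lvl v = i ∨ lvl v = i + 1 → f v = 0) →
      quadForm G f ≤ lambdaTwo G * (f ⬝ᵥ f) := by
  classical
  let P : ℕ → Prop := fun i => ∀ f : V → ℝ, (∀ v, i ≤ lvl v → f v = 0) →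
    quadForm G f ≤ lambdaTwo G * (f ⬝ᵥ f)
  by_cases hP : ∀ i, P i
  -- The threshold exceeds every level, so no vanishing condition remains.
  · refine ⟨0, fun f _ => hP (∑ v, lvl v + 1) f fun v hv => ?_⟩
    have := single_le_sum (f := lvl) (fun _ _ => Nat.zero_le _) (mem_univ v)
    omega
  · push Not at hP
    have h0 : P 0 := fun f hf => by
      rw [show f = 0 from funext fun v => hf v (Nat.zero_le _)]
      simp [quadForm]
    -- By minimality of `i + 1`, levels below `i` satisfy the bound, while some `g` on levels up to
    -- `i` violates it. Levels above `i + 1` are not adjacent to `g`, so they satisfy the bound too.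
    obtain ⟨i, hi⟩ : ∃ i, Nat.find hP = i + 1 := by
      refine Nat.exists_eq_succ_of_ne_zero fun h => ?_
      exact Nat.find_spec hP (h ▸ h0)
    have hPi : P i := not_not.1 (Nat.find_min hP (m := i) (by omega))
    have hPi1 : ¬ P (i + 1) := hi ▸ Nat.find_spec hP
    simp only [P, not_forall, not_le] at hPi1
    obtain ⟨g, hg0, hg⟩ := hPi1
    refine ⟨i, fun f hf => ?_⟩
    let f₁ : V → ℝ := fun v => if lvl v < i then f v else 0
    let f₂ : V → ℝ := fun v => if lvl v < i then 0 else f v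
    have hf12 : f = (1 : ℝ) • f₁ + (1 : ℝ) • f₂ := by
      ext v
      by_cases h : lvl v < i <;> simp [f₁, f₂, h]
    have hf₂ : ∀ v, f₂ v ≠ 0 → i + 1 < lvl v := by
      intro v hv
      by_contra! h
      by_cases h' : lvl v < i
      · simp [f₂, h'] at hv
      · simp only [f₂, if_neg h'] at hv
        exact hv (hf v (by omega))
    have hf₁ : ∀ v, f₁ v ≠ 0 → lvl v < i := by
      intro v hv
      by_contra h
      simp [f₁, h] at hv
    have hg' : ∀ v, g v ≠ 0 → lvl v ≤ i := fun v hv => by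
      by_contra! h
      exact hv (hg0 v h)
    have sep : ∀ v w, lvl v ≤ i → i + 1 < lvl w → v ≠ w ∧ ¬ G.Adj v w := by
      intro v w hv hw
      refine ⟨fun h => ?_, fun h => ?_⟩
      · rw [h] at hv; omega
      · have := hadj v w h
        omega
    have h12 : NonAdj G f₁ f₂ := fun v w hv hw => sep v w (hf₁ v hv).le (hf₂ w hw)
    have h2g : NonAdj G g f₂ := fun v w hv hw => sep v w (hg' v hv) (hf₂ w hw)
    have q1 := hPi f₁ fun v hv => by simp [f₁, hv.not_gt]
    have q2 := h2g.symm.quadForm_le_lambdaTwo G hg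
    rw [hf12, h12.quadForm_add_smul, h12.dotProduct_add_smul]
    linarith

theorem adjMultiplicity_lambdaTwo_le_of_card_level_le (hconn : G.Connected) (u : V) {M : ℕ}
    (hM : ∀ k, #{w | G.dist u w = k} ≤ M) : adjMultiplicity G (lambdaTwo G) ≤ 4 * M := by
  have hadj : ∀ v w, G.Adj v w → G.dist u w ≤ G.dist u v + 1 := fun v w h => by
    have := hconn.dist_triangle (u := u) (v := v) (w := w)
    rwa [SimpleGraph.dist_eq_one_iff_adj.2 h] at this
  obtain ⟨i, hi⟩ := exists_level_quadForm_le hadj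
  by_cases hX : ({w | G.dist u w = i ∨ G.dist u w = i + 1} : Finset V).Nonempty
  -- Neighbours of levels `i` and `i + 1` lie in levels `i - 1` to `i + 2`; for `i = 0` the
  -- truncated subtraction leaves three levels.
  · have h := adjMultiplicity_le_card hconn (Y := (Icc (i - 1) (i + 2)).biUnion
      fun k => ({w | G.dist u w = k} : Finset V)) hX ?_ ?_ (fun f hf => hi f fun v hv =>
        hf v (by simpa using hv))
    · refine h.trans ((card_biUnion_le_card_mul _ _ _ fun k _ => hM k).trans ?_)
      refine Nat.mul_le_mul_right _ ?_
      rw [Nat.card_Icc]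
      omega
    · intro v hv
      simp only [mem_filter, mem_univ, true_and] at hv
      simp only [mem_biUnion, mem_Icc, mem_filter, mem_univ, true_and, exists_eq_right']
      omega
    · intro v hv w hvw
      simp only [mem_filter, mem_univ, true_and] at hv
      simp only [mem_biUnion, mem_Icc, mem_filter, mem_univ, true_and, exists_eq_right']
      have h1 := hadj v w hvw
      have h2 := hadj w v hvw.symm
      omega
  -- If both levels are empty, the bound holds for every vector, so any nonempty `X` works; `{u}`
  -- has its neighbours in level 1.
  · have h := adjMultiplicity_le_card hconn (X := {u})
      (Y := (range 2).biUnion fun k => ({w | G.dist u w = k} : Finset V)) (by simp) ?_ ?_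
      (fun f _ => hi f fun v hv => (hX ⟨v, by simpa using hv⟩).elim)
    · refine h.trans ((card_biUnion_le_card_mul _ _ _ fun k _ => hM k).trans ?_)
      rw [card_range]
      omega
    · simp
    · intro v hv w hvw
      rw [mem_singleton.1 hv] at hvw
      simp [SimpleGraph.dist_eq_one_iff_adj.2 hvw]

end Levels

end EigMult

/-! ### Combining the two cases. -/

/-- The first conjunct says that the constant is well defined: it is attained as the least positive
integer `n` with `λ₁(T(n, n, n)) > l`. -/
theorem theorem1p3 {V : Type*} [Fintype V] [DecidableEq V] [Nontrivial V] (G : SimpleGraph V)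
    [DecidableRel G.Adj] (hconn : G.Connected) (Δ : ℝ) (hΔ : (G.maxDegree : ℝ) ≤ Δ)
    (l : ℝ) (hl : EigMult.lambdaTwo G ≤ l) (hl' : l < 3 / √2) :
    IsLeast (EigMult.spiderSet l) (EigMult.nConst l) ∧
      (EigMult.adjMultiplicity G (EigMult.lambdaTwo G) : ℝ) ≤
        2 * (EigMult.nConst l : ℝ) * Δ ^ (EigMult.nConst l + 3) * (1 + Δ + Δ ^ 2) := by
  have hmem : EigMult.nConst l ∈ EigMult.spiderSet l :=
    Nat.sInf_mem (EigMult.spiderSet_nonempty hl')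
  refine ⟨⟨hmem, fun k hk => Nat.sInf_le hk⟩, ?_⟩
  obtain ⟨hn, hln⟩ := hmem
  set n := EigMult.nConst l
  obtain ⟨u⟩ := (inferInstance : Nonempty V)
  have hd : 1 ≤ G.maxDegree :=
    (hconn.preconnected.degree_pos_of_nontrivial u).trans_le (G.degree_le_maxDegree u)
  suffices h : EigMult.adjMultiplicity G (EigMult.lambdaTwo G) ≤
      2 * n * G.maxDegree ^ (n + 3) * (1 + G.maxDegree + G.maxDegree ^ 2) by
    have h' : (EigMult.adjMultiplicity G (EigMult.lambdaTwo G) : ℝ) ≤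
        2 * n * (G.maxDegree : ℝ) ^ (n + 3) * (1 + G.maxDegree + (G.maxDegree : ℝ) ^ 2) := by
      exact_mod_cast h
    refine h'.trans ?_
    have hΔ0 : 0 ≤ Δ := (Nat.cast_nonneg _).trans hΔ
    gcongr
  by_cases hG : (EigMult.spider n).IsContained G
  · obtain ⟨φ⟩ := hG
    have hd2 : 2 ≤ G.maxDegree := by
      have hφ : Function.Injective φ := φ.injective'
      have hsub : ({φ (some (0, ⟨0, hn⟩)), φ (some (1, ⟨0, hn⟩))} : Finset V) ⊆
          G.neighborFinset (φ none) := by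
        intro v hv
        rw [SimpleGraph.mem_neighborFinset]
        rcases Finset.mem_insert.1 hv with rfl | hv
        · exact φ.toHom.map_adj rfl
        · rw [Finset.mem_singleton.1 hv]
          exact φ.toHom.map_adj rfl
      have h := Finset.card_le_card hsub
      rw [Finset.card_pair (fun e => by simpa using hφ e)] at h
      exact h.trans (G.degree_le_maxDegree _)
    refine (EigMult.adjMultiplicity_lambdaTwo_le_of_copy hconn φ (hl.trans_lt hln)).trans ?_
    refine Nat.mul_le_mul_right _ ?_
    -- The spider has `3n + 1 ≤ 4n` vertices, and this factor 2 gives `4n ≤ 2n * G.maxDegree ^ (n +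
    -- 3)`.
    have hpow : 2 ≤ G.maxDegree ^ (n + 3) := hd2.trans (Nat.le_self_pow (by omega) _)
    simp only [Fintype.card_option, Fintype.card_prod, Fintype.card_fin]
    nlinarith
  · obtain ⟨p, hp⟩ := EigMult.exists_isParent_dist hconn u
    -- The bound `8 * G.maxDegree ^ n` is absorbed through `8 ≤ G.maxDegree ^ 3`, which needs degree
    -- at least 2. In degree 1 each level has at most one vertex, and `4 ≤ 6n` suffices.
    rcases hd.eq_or_lt with hd1 | hd2
    · have hM : ∀ k, Finset.card {w | G.dist u w = k} ≤ 1 := fun k => by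
        simpa [← hd1] using hp.card_level_le_pow k
      refine (EigMult.adjMultiplicity_lambdaTwo_le_of_card_level_le hconn u hM).trans ?_
      rw [← hd1, one_pow]
      omega
    · refine (EigMult.adjMultiplicity_lambdaTwo_le_of_card_level_le hconn u
        (hp.card_level_le hd hG)).trans ?_
      have h8 : 2 ^ 3 ≤ G.maxDegree ^ 3 := Nat.pow_le_pow_left hd2 3
      calc 4 * (2 * G.maxDegree ^ n) = 1 * (G.maxDegree ^ n * 2 ^ 3) * 1 := by ring
        _ ≤ 2 * n * (G.maxDegree ^ n * G.maxDegree ^ 3) * (1 + G.maxDegree + G.maxDegree ^ 2) := by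
          gcongr <;> omega
        _ = _ := by rw [pow_add]
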